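/- Let $N\ge 3$ be an odd integer and $F=\mathbf Z/2\mathbf Z$. The set of all subsets of $\{1,\dots,N\}$ is an $F$-vector space under symmetric difference; $E_N$ is the subspace of subsets of even cardinality. For integers $a,b$ write $[a,b]=\{h\in\mathbf Z: a\le h\le b\}$ (empty if $a>b$). **Families of pairs.** Let $\mathcal P_N$ be the set of finite families $B$ of pairwise disjoint two-element subsets of $[1,N]$. For $B\in\mathcal P_N$ let $\mathrm{supp}(B)$ be the union of its members, let $\langle B\rangle$ be the $F$-span of its members, and let $B^0$ (resp. $B^1$) be the set of $\{i,j\}\in B$ with $i-j$ even (resp. odd). A set is *$0$-covered* if it is a (possibly empty) disjoint union of intervals $[a,b]$ with $a<b$, $\{a,b\}\in B^1$; it is *$1$-covered* if it is the disjoint union of a $0$-covered set and a one-element set. Let ${}^*\mathcal P_N$ be the set of $B\in\mathcal P_N$ such that $[i+1,j-1]$ is $0$-covered whenever $i<j$, $\{i,j\}\in B^1$, and such that there are $i_1<i_2<\dots<i_{2s}$ with $B^0=\{\{i_{2s},i_1\},\{i_{2s-1},i_2\},\dots,\{i_{s+1},i_s\}\}$ and with $[i_k+1,i_{k+1}-1]$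 $0$-covered for all $1\le k\le 2s-1$, $k\ne s$; here $s=|B^0|$. For $B\in{}^*\mathcal P_N$ consider the conditions: (I) $s=0$, or $s\ge 1$ and $[1,i_1-1]$, $[i_{2s}+1,N]$ are $0$-covered. (II) $N\notin\mathrm{supp}(B)$, and either $s=0$, or $s$ is odd and either (i) $[1,i_1-1]$ is $1$-covered and $[i_{2s}+1,N-1]$ is $0$-covered, or (ii) $[1,i_1-1]$ is $0$-covered and $[i_{2s}+1,N-1]$ is $1$-covered. (III) (I) holds, and $\{i,N\}\in B$ for some $i$ with $i\equiv s\pmod 2$. Let $\mathcal X_{N-1},\mathcal X_{N-2}^+,\mathcal X_{N-2}^-$ be the sets of $B\in{}^*\mathcal P_N$ satisfying (I), (II), (III) respectively, and $\mathcal X_{N-2}=\mathcal X_{N-2}^+\sqcup\mathcal X_{N-2}^-$. For $B\in\mathcal X_{N-2}^+$ with $s\geq 1$ let $u_B$ be the unique $u$ such that, in case (i), $u\in[1,i_1-1]$ and $[1,u-1]$, $[u+1,i_1-1]$ are $0$-covered, and, in case (ii), $u\in[i_{2s}+1,N-1]$ and $[i_{2s}+1,u-1]$, $[u+1,N-1]$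 are $0$-covered. **The maps.** For $i<j$ in $[1,N]$ let $[[\{i,j\}]]=[i,j]$ if $j-i$ is odd and $[[\{i,j\}]]=[j,N]\cup[1,i]$ if $j-i$ is even. For $B\in\mathcal X_{N-1}$ put $\epsilon(B)=\sum_{X\in B}[[X]]\in E_N$. For $B\in\mathcal X_{N-2}$ put ${}'\epsilon(B)=\sum_{X\in B}[[X]]+c_B\in E_N$, where $c_B=0$ unless $B\in\mathcal X_{N-2}^+$ and $B^0\neq\emptyset$, in which case $c_B=[u_B,N]$ if $u_B$ is even and $c_B=\{N\}+[1,u_B]$ if $u_B$ is odd. Put $\varphi(B)=B\sqcup\{\{u_B,N\}\}$ if $B\in\mathcal X_{N-2}^+$ and $B^0\ne\emptyset$, and $\varphi(B)=B$ for all other $B\in\mathcal X_{N-2}$. **The relations.** For $B',B\in\mathcal X_{N-1}$ write $B'\le B$ if there is a sequence $B'=B_0,B_1,\dots,B_h=B$ $(h\ge0)$ in $\mathcal X_{N-1}$ with $\epsilon(B_k)\in\langle B_{k+1}\rangle$ for $0\le k<h$. For $B',B\in\mathcal X_{N-2}$ write $B'\preceq B$ if there is a sequence $B'=B_0,B_1,\dots,B_h=B$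 $(h\ge0)$ in $\mathcal X_{N-2}$ with ${}'\epsilon(B_k)\in\langle B_{k+1}\rangle$ for $0\le k<h$. **Claim.** The relation $\preceq$ is a partial order on $\mathcal X_{N-2}$. Moreover, if $B',B\in\mathcal X_{N-2}$ satisfy $B'\preceq B$, then $\varphi(B'),\varphi(B)\in\mathcal X_{N-1}$ and $\varphi(B')\le\varphi(B)$. -/

import Mathlib

namespace PairOrder

/-! Subsets of `S_N = {1, …, N}` are written as `Finset ℕ`; a family of two-element subsets is a
`Finset (Finset ℕ)`. -/

/-- The `F`-vector space (`F = ℤ/2ℤ`) of all subsets of `{1, …, N}` under symmetric difference,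
realized as the space of `F`-valued (indicator) functions on `{1, …, N}`. -/
abbrev Vec (N : ℕ) : Type := ↥(Finset.Icc 1 N) → ZMod 2

/-- The vector of a subset of `{1, …, N}`: its indicator function. -/
def ind (N : ℕ) (X : Finset ℕ) : Vec N := fun k => if (k : ℕ) ∈ X then 1 else 0

/-- `𝒫_N`: finite families of pairwise disjoint two-element subsets of `{1, …, N}`. -/
def IsPairing (N : ℕ) (B : Finset (Finset ℕ)) : Prop :=
  (∀ X ∈ B, X ⊆ Finset.Icc 1 N ∧ X.card = 2) ∧ (∀ X ∈ B, ∀ Y ∈ B, X ≠ Y → Disjoint X Y)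

/-- `supp(B)`, the union of the members of `B`. -/
def supp (B : Finset (Finset ℕ)) : Finset ℕ := B.biUnion id

/-- `X` consists of integers of one and the same parity. -/
def SameParity (X : Finset ℕ) : Prop := ∀ i ∈ X, ∀ j ∈ X, i ≡ j [MOD 2]

instance (X : Finset ℕ) : Decidable (SameParity X) := by unfold SameParity; infer_instance

/-- `B⁰`: the pairs `{i, j} ∈ B` with `i - j` even. -/
def even (B : Finset (Finset ℕ)) : Finset (Finset ℕ) := B.filter (fun X => SameParity X)

/-- `B¹`: the pairs `{i, j} ∈ B` with `i - j` odd. -/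
def odd (B : Finset (Finset ℕ)) : Finset (Finset ℕ) := B.filter (fun X => ¬ SameParity X)

/-- `X` is `0`-covered by `B¹`: it is a disjoint union of (possibly no) intervals `[a, b]` with
`a < b` and `{a, b} ∈ B¹`. -/
def Covered0 (B : Finset (Finset ℕ)) (X : Finset ℕ) : Prop :=
  ∃ T : Finset (ℕ × ℕ), (∀ p ∈ T, p.1 < p.2 ∧ ({p.1, p.2} : Finset ℕ) ∈ odd B) ∧
    (∀ p ∈ T, ∀ q ∈ T, p ≠ q → Disjoint (Finset.Icc p.1 p.2) (Finset.Icc q.1 q.2)) ∧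
    X = T.biUnion (fun p => Finset.Icc p.1 p.2)

/-- `X` is `1`-covered by `B¹`: it is the disjoint union of a one-element set and a `0`-covered
set. -/
def Covered1 (B : Finset (Finset ℕ)) (X : Finset ℕ) : Prop := ∃ u ∈ X, Covered0 B (X.erase u)

/-- `i 1 < i 2 < … < i (2s)` is the sequence `i_*(B)`: one has
`B⁰ = {{i_{2s}, i_1}, {i_{2s-1}, i_2}, …, {i_{s+1}, i_s}}`, and the intervals
`[i_k + 1, i_{k+1} - 1]`, `1 ≤ k ≤ 2s - 1`, `k ≠ s`, are `0`-covered by `B¹`.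
Only the values `i k` with `1 ≤ k ≤ 2s` matter. -/
def IsSeq (B : Finset (Finset ℕ)) (s : ℕ) (i : ℕ → ℕ) : Prop :=
  StrictMonoOn i (Set.Icc 1 (2 * s)) ∧
  even B = (Finset.Icc 1 s).image (fun k => ({i (2 * s + 1 - k), i k} : Finset ℕ)) ∧
  ∀ k, 1 ≤ k → k < 2 * s → k ≠ s → Covered0 B (Finset.Ioo (i k) (i (k + 1)))

/-- `*𝒫_N`. -/
def IsStar (N : ℕ) (B : Finset (Finset ℕ)) : Prop :=
  IsPairing N B ∧
  (∀ i j : ℕ, i < j → ({i, j} : Finset ℕ) ∈ odd B → Covered0 B (Finset.Ioo i j)) ∧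
  ∃ s i, IsSeq B s i

/-- Condition (I): either `s = 0`, or `[1, i_1 - 1]` and `[i_{2s} + 1, N]` are `0`-covered. -/
def CondI (N : ℕ) (B : Finset (Finset ℕ)) : Prop :=
  ∃ s i, IsSeq B s i ∧
    (s = 0 ∨ (1 ≤ s ∧ Covered0 B (Finset.Ico 1 (i 1)) ∧ Covered0 B (Finset.Ioc (i (2 * s)) N)))

/-- Case (i) of condition (II): `[1, i_1 - 1]` is `1`-covered, `[i_{2s} + 1, N - 1]` is
`0`-covered. -/
def CaseLeft (N : ℕ) (B : Finset (Finset ℕ)) (s : ℕ) (i : ℕ → ℕ) : Prop :=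
  Covered1 B (Finset.Ico 1 (i 1)) ∧ Covered0 B (Finset.Ioo (i (2 * s)) N)

/-- Case (ii) of condition (II): `[1, i_1 - 1]` is `0`-covered, `[i_{2s} + 1, N - 1]` is
`1`-covered. -/
def CaseRight (N : ℕ) (B : Finset (Finset ℕ)) (s : ℕ) (i : ℕ → ℕ) : Prop :=
  Covered0 B (Finset.Ico 1 (i 1)) ∧ Covered1 B (Finset.Ioo (i (2 * s)) N)

/-- Condition (II). -/
def CondII (N : ℕ) (B : Finset (Finset ℕ)) : Prop :=
  N ∉ supp B ∧ ∃ s i, IsSeq B s i ∧ (s = 0 ∨ (Odd s ∧ (CaseLeft N B s i ∨ CaseRight N B s i)))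

/-- Condition (III): (I) holds, and `{i, N} ∈ B` for some `i` of the same parity as
`s = |B⁰|`. -/
def CondIII (N : ℕ) (B : Finset (Finset ℕ)) : Prop :=
  CondI N B ∧
  (Even (even B).card → ∃ i : ℕ, Even i ∧ ({i, N} : Finset ℕ) ∈ B) ∧
  (Odd (even B).card → ∃ i : ℕ, Odd i ∧ ({i, N} : Finset ℕ) ∈ B)

/-- `𝒳_{N-1}`. -/
def X1 (N : ℕ) : Set (Finset (Finset ℕ)) := {B | IsStar N B ∧ CondI N B}

/-- `𝒳_{N-2}^+`. -/
def X2plus (N : ℕ) : Set (Finset (Finset ℕ)) := {B | IsStar N B ∧ CondII N B}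

/-- `𝒳_{N-2}^-`. -/
def X2minus (N : ℕ) : Set (Finset (Finset ℕ)) := {B | IsStar N B ∧ CondIII N B}

/-- `𝒳_{N-2}`. -/
def X2 (N : ℕ) : Set (Finset (Finset ℕ)) := X2plus N ∪ X2minus N

/-- `u` is the exceptional point of `B ∈ 𝒳_{N-2}^+` with `B⁰ ≠ ∅`: in case (i), `u ∈ [1, i_1 - 1]`
and `[1, u - 1]`, `[u + 1, i_1 - 1]` are `0`-covered; in case (ii), `u ∈ [i_{2s} + 1, N - 1]` and
`[i_{2s} + 1, u - 1]`, `[u + 1, N - 1]` are `0`-covered. -/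
def IsExc (N : ℕ) (B : Finset (Finset ℕ)) (u : ℕ) : Prop :=
  ∃ s i, IsSeq B s i ∧ Odd s ∧
    ((CaseLeft N B s i ∧ u ∈ Finset.Ico 1 (i 1) ∧
        Covered0 B (Finset.Ico 1 u) ∧ Covered0 B (Finset.Ioo u (i 1))) ∨
      (CaseRight N B s i ∧ u ∈ Finset.Ioo (i (2 * s)) N ∧
        Covered0 B (Finset.Ioo (i (2 * s)) u) ∧ Covered0 B (Finset.Ioo u N)))

open Classical in
/-- `u_B`, the (unique) exceptional point; the value `0` is used only where there is none. -/
noncomputable def exc (N : ℕ) (B : Finset (Finset ℕ)) : ℕ :=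
  if h : ∃ u, IsExc N B u then h.choose else 0

/-- `[[X]]` for a pair `X = {i < j}`: the interval `[i, j]` if `j - i` is odd, and
`[j, N] ∪ [1, i]` if `j - i` is even. -/
def bracket (N : ℕ) (X : Finset ℕ) : Finset ℕ :=
  (Finset.Icc 1 N).filter (fun k =>
    if SameParity X then (∀ x ∈ X, x ≤ k) ∨ (∀ x ∈ X, k ≤ x)
    else (∃ x ∈ X, x ≤ k) ∧ (∃ x ∈ X, k ≤ x))

/-- `ε(B) = ∑_{X ∈ B} [[X]]`. -/
def eps (N : ℕ) (B : Finset (Finset ℕ)) : Vec N := ∑ X ∈ B, ind N (bracket N X)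

open Classical in
/-- `′ε(B)`. -/
noncomputable def eps' (N : ℕ) (B : Finset (Finset ℕ)) : Vec N :=
  if B ∈ X2plus N ∧ (even B).card ≠ 0 then
    if Even (exc N B) then
      ∑ X ∈ B, ind N (bracket N X) + ind N (Finset.Icc (exc N B) N)
    else
      ∑ X ∈ B, ind N (bracket N X) + ind N {N} + ind N (Finset.Icc 1 (exc N B))
  else ∑ X ∈ B, ind N (bracket N X)

open Classical in
/-- `φ(B)`: equal to `B ⊔ {{u_B, N}}` if `B ∈ 𝒳_{N-2}^+` and `B⁰ ≠ ∅`, and to `B` for all other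
`B ∈ 𝒳_{N-2}`. -/
noncomputable def phi (N : ℕ) (B : Finset (Finset ℕ)) : Finset (Finset ℕ) :=
  if B ∈ X2plus N ∧ (even B).card ≠ 0 then insert ({exc N B, N} : Finset ℕ) B else B

/-- `⟨B⟩`: the `F`-subspace spanned by the members of `B`. -/
def spanB (N : ℕ) (B : Finset (Finset ℕ)) : Submodule (ZMod 2) (Vec N) :=
  Submodule.span (ZMod 2) (ind N '' (B : Set (Finset ℕ)))

/-- `B' ≤ B` on `𝒳_{N-1}`: there is a chain `B' = B_0, B_1, …, B_h = B` (`h ≥ 0`) in `𝒳_{N-1}`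
with `ε(B_k) ∈ ⟨B_{k+1}⟩` for `0 ≤ k < h`. -/
def le1 (N : ℕ) : X1 N → X1 N → Prop :=
  Relation.ReflTransGen (fun B C => eps N B.1 ∈ spanB N C.1)

/-- `B' ⪯ B` on `𝒳_{N-2}`: there is a chain `B' = B_0, B_1, …, B_h = B` (`h ≥ 0`) in `𝒳_{N-2}`
with `′ε(B_k) ∈ ⟨B_{k+1}⟩` for `0 ≤ k < h`. -/
def preceq (N : ℕ) : X2 N → X2 N → Prop :=
  Relation.ReflTransGen (fun B C => eps' N B.1 ∈ spanB N C.1)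

end PairOrder

/-! Place `1, …, N` on a circle. Each pair `X` gives an arc `[[X]]`, and `openCount B k` counts the
arcs of `B` over the cut after `k`. For `B ∈ 𝒳_{N-1}` every arc is a union of members of `B`
(`isArcSystem_of_mem_X1`). So the arcs are nested like brackets and `B` can be recovered from
`openCount B` (`IsArcSystem.eq_of_openCount_eq`).

The order makes `openCount` monotone. Read `ε(B)` as signs `d j = (-1) ^ depth j` and take the
antiperiodic walk with steps `2 (-1)^j d j`. For `B` itself its value at `k` has absolute value `1 +
2 * openCount B k` (`IsArcSystem.walk_depth`). If `ε(B) ∈ ⟨C⟩`, then `d` is constant on each pair of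
`C` and is `1` off `supp C`. Summing the same walk along the pairs of `C`, an arc over the cut
contributes at most `2`, any other arc `0`, and the unmatched points together `±1`. Hence the bound
`1 + 2 * openCount C k` (`IsArcSystem.abs_walk_le`), so `openCount B ≤ openCount C`, and `≤` is
antisymmetric.

The map `φ` transports this to `𝒳_{N-2}`: it lands in `𝒳_{N-1}`, it is injective, `′ε = ε ∘ φ`, and
`⟨B⟩ ⊆ ⟨φ(B)⟩`. A chain for `⪯` thus becomes a chain for `≤`, and antisymmetry pulls back. -/

namespace PairOrder

/-! ### Pairs, arcs and cuts -/

/-- The arc `[[X]]` passes over the cut between `k` and `k + 1` of the circle `1, …, N`. -/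
def OpenAt (k : ℕ) (X : Finset ℕ) : Prop :=
  if SameParity X then (∀ x ∈ X, x ≤ k) ∨ (∀ x ∈ X, k < x)
  else (∃ x ∈ X, x ≤ k) ∧ (∃ x ∈ X, k < x)

instance (k : ℕ) (X : Finset ℕ) : Decidable (OpenAt k X) := by
  unfold OpenAt; infer_instance

/-- The number of arcs of `B` over the cut between `k` and `k + 1`. -/
def openCount (B : Finset (Finset ℕ)) (k : ℕ) : ℕ := (B.filter (OpenAt k)).card

/-- The number of arcs of `B` that contain `k`. -/
def depth (N : ℕ) (B : Finset (Finset ℕ)) (k : ℕ) : ℕ :=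
  (B.filter (fun X => k ∈ bracket N X)).card

/-- `S` is a union of members of `B`. -/
def Saturated (B : Finset (Finset ℕ)) (S : Finset ℕ) : Prop := ∀ k ∈ S, ∃ Y ∈ B, k ∈ Y ∧ Y ⊆ S

/-- Every arc of the pairing `B` is a union of members of `B`. -/
structure IsArcSystem (N : ℕ) (B : Finset (Finset ℕ)) : Prop where
  pairing : IsPairing N B
  saturated : ∀ X ∈ B, Saturated B (bracket N X)

lemma sameParity_pair (i j : ℕ) : SameParity {i, j} ↔ i % 2 = j % 2 := by
  simp only [SameParity, Nat.ModEq, Finset.mem_insert, Finset.mem_singleton]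
  refine ⟨fun h => h i (Or.inl rfl) j (Or.inr rfl), fun h => ?_⟩
  rintro _ (rfl | rfl) _ (rfl | rfl) <;> simp [h]

lemma mem_bracket_pair {N i j k : ℕ} (h : i < j) : k ∈ bracket N {i, j} ↔
    (1 ≤ k ∧ k ≤ N) ∧
      ((i % 2 = j % 2 ∧ (j ≤ k ∨ k ≤ i)) ∨ (i % 2 ≠ j % 2 ∧ i ≤ k ∧ k ≤ j)) := by
  unfold bracket
  rw [Finset.mem_filter, Finset.mem_Icc]
  have hs := sameParity_pair i j
  split_ifs with hp <;> simp [← hs, hp] <;> intros <;> omega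

lemma openAt_pair {i j k : ℕ} (h : i < j) : OpenAt k {i, j} ↔
    ((i % 2 = j % 2 ∧ (j ≤ k ∨ k < i)) ∨ (i % 2 ≠ j % 2 ∧ i ≤ k ∧ k < j)) := by
  unfold OpenAt
  have hs := sameParity_pair i j
  split_ifs with hp <;> simp [← hs, hp] <;> omega

/-! ### Change of the arc count from one cut to the next -/

section Pairing

variable {N : ℕ} {B : Finset (Finset ℕ)}

lemma IsPairing.exists_pair (hB : IsPairing N B) {X : Finset ℕ} (hX : X ∈ B) :
    ∃ i j, 1 ≤ i ∧ i < j ∧ j ≤ N ∧ X = {i, j} := by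
  obtain ⟨hs, hc⟩ := hB.1 X hX
  obtain ⟨a, b, hab, rfl⟩ := Finset.card_eq_two.1 hc
  have ha := Finset.mem_Icc.1 (hs (Finset.mem_insert_self a {b}))
  have hb := Finset.mem_Icc.1 (hs (Finset.mem_insert_of_mem (Finset.mem_singleton_self b)))
  rcases lt_or_gt_of_ne hab with h | h
  · exact ⟨a, b, ha.1, h, hb.2, rfl⟩
  · exact ⟨b, a, hb.1, h, ha.2, Finset.pair_comm a b⟩

lemma IsPairing.eq_of_mem (hB : IsPairing N B) {X Y : Finset ℕ} (hX : X ∈ B) (hY : Y ∈ B)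
    {k : ℕ} (hkX : k ∈ X) (hkY : k ∈ Y) : X = Y := by
  by_contra h
  exact Finset.disjoint_left.1 (hB.2 X hX Y hY h) hkX hkY

lemma mem_supp {k : ℕ} : k ∈ supp B ↔ ∃ X ∈ B, k ∈ X := by simp [supp]

lemma IsPairing.supp_subset (hB : IsPairing N B) : supp B ⊆ Finset.Icc 1 N :=
  Finset.biUnion_subset.2 fun X hX => (hB.1 X hX).1

lemma IsPairing.sum_split {M : Type*} [AddCommMonoid M] (hB : IsPairing N B) (f : ℕ → M) :
    ∑ k ∈ Finset.Icc 1 N, f k = ∑ k ∈ Finset.Icc 1 N \ supp B, f k + ∑ X ∈ B, ∑ k ∈ X, f k := by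
  rw [← Finset.sum_sdiff hB.supp_subset]
  congr 1
  exact Finset.sum_biUnion fun X hX Y hY h => hB.2 X hX Y hY h

lemma IsPairing.exists_unmatched (hB : IsPairing N B) (hN : Odd N) :
    ∃ u ∈ Finset.Icc 1 N, u ∉ supp B := by
  by_contra! h
  have h1 : supp B = Finset.Icc 1 N := hB.supp_subset.antisymm h
  have h2 : (supp B).card = ∑ X ∈ B, 2 := by
    refine (Finset.card_biUnion fun X hX Y hY h => hB.2 X hX Y hY h).trans ?_
    exact Finset.sum_congr rfl fun X hX => (hB.1 X hX).2
  rw [h1] at h2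
  simp at h2
  obtain ⟨m, hm⟩ := hN
  omega

lemma Saturated.subset (hB : IsPairing N B) {S : Finset ℕ} (hS : Saturated B S) {Y : Finset ℕ}
    (hY : Y ∈ B) {k : ℕ} (hkY : k ∈ Y) (hkS : k ∈ S) : Y ⊆ S := by
  obtain ⟨Z, hZ, hkZ, hZS⟩ := hS k hkS
  rwa [hB.eq_of_mem hY hZ hkY hkZ]

lemma IsPairing.openAt_succ_iff (hB : IsPairing N B) {X : Finset ℕ} (hX : X ∈ B) {k : ℕ}
    (hk : k + 1 ∉ X) : OpenAt (k + 1) X ↔ OpenAt k X := by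
  obtain ⟨i, j, -, hij, -, rfl⟩ := hB.exists_pair hX
  simp only [Finset.mem_insert, Finset.mem_singleton] at hk
  rw [openAt_pair hij, openAt_pair hij]
  omega

lemma IsPairing.openAt_succ_iff_not (hB : IsPairing N B) {X : Finset ℕ} (hX : X ∈ B) {k : ℕ}
    (hk : k + 1 ∈ X) : OpenAt (k + 1) X ↔ ¬ OpenAt k X := by
  obtain ⟨i, j, -, hij, -, rfl⟩ := hB.exists_pair hX
  simp only [Finset.mem_insert, Finset.mem_singleton] at hk
  rw [openAt_pair hij, openAt_pair hij]
  omega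

lemma IsPairing.mem_bracket_iff_openAt (hB : IsPairing N B) {X : Finset ℕ} (hX : X ∈ B) {k : ℕ}
    (hkN : k ∈ Finset.Icc 1 N) (hk : k ∉ X) : k ∈ bracket N X ↔ OpenAt k X := by
  obtain ⟨i, j, -, hij, -, rfl⟩ := hB.exists_pair hX
  simp only [Finset.mem_insert, Finset.mem_singleton, Finset.mem_Icc] at hk hkN
  rw [openAt_pair hij, mem_bracket_pair hij]
  omega

lemma IsPairing.subset_bracket (hB : IsPairing N B) {X : Finset ℕ} (hX : X ∈ B) :
    X ⊆ bracket N X := by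
  obtain ⟨i, j, hi, hij, hj, rfl⟩ := hB.exists_pair hX
  intro k hk
  simp only [Finset.mem_insert, Finset.mem_singleton] at hk
  rw [mem_bracket_pair hij]
  omega

lemma IsPairing.openCount_succ_of_notMem (hB : IsPairing N B) {k : ℕ} (hk : k + 1 ∉ supp B) :
    openCount B (k + 1) = openCount B k := by
  unfold openCount
  congr 1
  exact Finset.filter_congr fun X hX =>
    hB.openAt_succ_iff hX fun h => hk (mem_supp.2 ⟨X, hX, h⟩)

lemma IsPairing.notMem_of_ne (hB : IsPairing N B) {X Y : Finset ℕ} (hX : X ∈ B) (hY : Y ∈ B)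
    (h : Y ≠ X) {k : ℕ} (hk : k ∈ X) : k ∉ Y := fun hkY => h (hB.eq_of_mem hY hX hkY hk)

lemma IsPairing.openCount_succ_of_open (hB : IsPairing N B) {X : Finset ℕ} (hX : X ∈ B) {k : ℕ}
    (hk : k + 1 ∈ X) (ho : OpenAt (k + 1) X) : openCount B (k + 1) = openCount B k + 1 := by
  unfold openCount
  have hn : X ∉ B.filter (OpenAt k) := fun h =>
    (hB.openAt_succ_iff_not hX hk).1 ho (Finset.mem_filter.1 h).2
  rw [← Finset.card_insert_of_notMem hn]
  congr 1
  ext Y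
  simp only [Finset.mem_filter, Finset.mem_insert]
  by_cases hYX : Y = X
  · subst hYX; simp [hX, ho]
  · simp only [hYX, false_or]
    exact and_congr_right fun hY => hB.openAt_succ_iff hY (hB.notMem_of_ne hX hY hYX hk)

lemma IsPairing.openCount_succ_of_not_open (hB : IsPairing N B) {X : Finset ℕ} (hX : X ∈ B)
    {k : ℕ} (hk : k + 1 ∈ X) (ho : ¬ OpenAt (k + 1) X) :
    openCount B k = openCount B (k + 1) + 1 := by
  unfold openCount
  have hn : X ∉ B.filter (OpenAt (k + 1)) := fun h => ho (Finset.mem_filter.1 h).2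
  rw [← Finset.card_insert_of_notMem hn]
  congr 1
  ext Y
  simp only [Finset.mem_filter, Finset.mem_insert]
  by_cases hYX : Y = X
  · subst hYX
    have := hB.openAt_succ_iff_not hX hk
    simp only [hX, true_and, true_or, iff_true]
    tauto
  · simp only [hYX, false_or]
    exact and_congr_right fun hY => (hB.openAt_succ_iff hY (hB.notMem_of_ne hX hY hYX hk)).symm

/-- An arc of `B` not ending at `k` contains `k` exactly when it passes over the cut after `k`. Only
`X` can make a difference: it always contains `k`, but passes over that cut only if it starts at
`k`. -/
lemma IsPairing.depth_of_open (hB : IsPairing N B) {X : Finset ℕ} (hX : X ∈ B) {k : ℕ}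
    (hk : k ∈ X) (ho : OpenAt k X) : depth N B k = openCount B k := by
  unfold openCount depth
  congr 1
  refine Finset.filter_congr fun Y hY => ?_
  by_cases hYX : Y = X
  · subst hYX
    exact iff_of_true (hB.subset_bracket hY hk) ho
  · exact hB.mem_bracket_iff_openAt hY ((hB.1 X hX).1 hk) (hB.notMem_of_ne hX hY hYX hk)

lemma IsPairing.depth_of_not_open (hB : IsPairing N B) {X : Finset ℕ} (hX : X ∈ B) {k : ℕ}
    (hk : k ∈ X) (ho : ¬ OpenAt k X) : depth N B k = openCount B k + 1 := by
  unfold openCount depth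
  have hn : X ∉ B.filter (OpenAt k) := fun h => ho (Finset.mem_filter.1 h).2
  rw [← Finset.card_insert_of_notMem hn]
  congr 1
  ext Y
  simp only [Finset.mem_filter, Finset.mem_insert]
  by_cases hYX : Y = X
  · subst hYX
    simp [hX, hB.subset_bracket hX hk]
  · simp only [hYX, false_or]
    exact and_congr_right fun hY =>
      hB.mem_bracket_iff_openAt hY ((hB.1 X hX).1 hk) (hB.notMem_of_ne hX hY hYX hk)

lemma IsPairing.openCount_last (hB : IsPairing N B) : openCount B N = openCount B 0 := by
  unfold openCount
  congr 1
  refine Finset.filter_congr fun X hX => ?_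
  obtain ⟨i, j, hi, hij, hj, rfl⟩ := hB.exists_pair hX
  rw [openAt_pair hij, openAt_pair hij]
  omega

end Pairing

/-! ### Arc systems and their unmatched points -/

section ArcSystem

variable {N : ℕ} {B C : Finset (Finset ℕ)}

lemma IsArcSystem.notMem_bracket (hB : IsArcSystem N B) {X : Finset ℕ} (hX : X ∈ B) {u : ℕ}
    (hu : u ∉ supp B) : u ∉ bracket N X := fun h =>
  let ⟨Y, hY, huY, _⟩ := hB.saturated X hX u h
  hu (mem_supp.2 ⟨Y, hY, huY⟩)

lemma IsArcSystem.depth_of_notMem (hB : IsArcSystem N B) {u : ℕ} (hu : u ∉ supp B) :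
    depth N B u = 0 := by
  rw [depth, Finset.card_eq_zero, Finset.filter_eq_empty_iff]
  exact fun X hX => hB.notMem_bracket hX hu

lemma IsArcSystem.openCount_of_notMem (hB : IsArcSystem N B) {u : ℕ} (huN : u ∈ Finset.Icc 1 N)
    (hu : u ∉ supp B) : openCount B u = 0 := by
  rw [openCount, Finset.card_eq_zero, Finset.filter_eq_empty_iff]
  intro X hX
  rw [← hB.pairing.mem_bracket_iff_openAt hX huN fun h => hu (mem_supp.2 ⟨X, hX, h⟩)]
  exact hB.notMem_bracket hX hu

/-! ### The arcs are determined by the number of arcs over each cut -/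

/-- `k` is a cut under the arc that starts at `p` and ends at `q`. -/
def Under (p q k : ℕ) : Prop := (p < q ∧ p ≤ k ∧ k < q) ∨ (q < p ∧ (p ≤ k ∨ k < q))

lemma IsArcSystem.openCount_le (hB : IsArcSystem N B) (hN : Odd N) {p q k : ℕ}
    (hX : {p, q} ∈ B) (hpq : p ≠ q) (ho : OpenAt p {p, q}) (hk : Under p q k) :
    openCount B p ≤ openCount B k := by
  refine Finset.card_le_card fun Y hY => ?_
  rw [Finset.mem_filter] at hY ⊢
  refine ⟨hY.1, ?_⟩
  obtain ⟨hYB, hYp⟩ := hY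
  -- An unmatched point lies on no arc, so two arcs never cover the circle together. This rules out
  -- that `Y` joins `p` and `q` the other way round.
  obtain ⟨u, huN, hu⟩ := hB.pairing.exists_unmatched hN
  have huX := hB.notMem_bracket hX hu
  have huY := hB.notMem_bracket hYB hu
  by_cases hYX : Y = {p, q}
  · subst hYX
    rcases lt_or_gt_of_ne hpq with h | h
    · rw [openAt_pair h] at ho ⊢
      unfold Under at hk; omega
    · rw [Finset.pair_comm, openAt_pair h] at ho ⊢
      unfold Under at hk; omega
  · have hpX : p ∈ ({p, q} : Finset ℕ) := by simp
    have hqX : q ∈ ({p, q} : Finset ℕ) := by simp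
    have hpN := (hB.pairing.1 _ hX).1 hpX
    have hpY := hB.pairing.notMem_of_ne hX hYB hYX hpX
    have hqY := hB.pairing.notMem_of_ne hX hYB hYX hqX
    have hpY' := (hB.pairing.mem_bracket_iff_openAt hYB hpN hpY).2 hYp
    have hqY' := (hB.saturated Y hYB).subset hB.pairing hX hpX hpY' hqX
    obtain ⟨a, b, ha, hab, hb, rfl⟩ := hB.pairing.exists_pair hYB
    simp only [Finset.mem_insert, Finset.mem_singleton, not_or] at hpY hqY
    rw [Finset.mem_Icc] at huN
    rw [mem_bracket_pair hab] at hpY' hqY' huY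
    rw [openAt_pair hab]
    unfold Under at hk
    rcases lt_or_gt_of_ne hpq with h | h
    · rw [openAt_pair h] at ho
      rw [mem_bracket_pair h] at huX
      omega
    · rw [Finset.pair_comm, openAt_pair h] at ho
      rw [Finset.pair_comm, mem_bracket_pair h] at huX
      omega

lemma IsArcSystem.openCount_lt (hB : IsArcSystem N B) {p q : ℕ}
    (hX : {p, q} ∈ B) (hpq : p ≠ q) (ho : OpenAt p {p, q}) :
    openCount B q < openCount B p := by
  have hpX : p ∈ ({p, q} : Finset ℕ) := by simp
  have hqX : q ∈ ({p, q} : Finset ℕ) := by simp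
  have hq : ¬ OpenAt q {p, q} := by
    rcases lt_or_gt_of_ne hpq with h | h
    · rw [openAt_pair h] at ho ⊢; omega
    · rw [Finset.pair_comm, openAt_pair h] at ho ⊢; omega
  refine Finset.card_lt_card (Finset.ssubset_iff_of_subset ?_ |>.2
    ⟨{p, q}, Finset.mem_filter.2 ⟨hX, ho⟩, fun h => hq (Finset.mem_filter.1 h).2⟩)
  intro Y hY
  rw [Finset.mem_filter] at hY ⊢
  obtain ⟨hYB, hYq⟩ := hY
  have hYX : Y ≠ {p, q} := by rintro rfl; exact hq hYq
  have hN := (hB.pairing.1 _ hX).1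
  have hqY := (hB.pairing.mem_bracket_iff_openAt hYB (hN hqX)
    (hB.pairing.notMem_of_ne hX hYB hYX hqX)).2 hYq
  exact ⟨hYB, (hB.pairing.mem_bracket_iff_openAt hYB (hN hpX)
    (hB.pairing.notMem_of_ne hX hYB hYX hpX)).1
      ((hB.saturated Y hYB).subset hB.pairing hX hqX hqY hpX)⟩

lemma IsPairing.exists_arc (hB : IsPairing N B) {X : Finset ℕ} (hX : X ∈ B) :
    ∃ p q, p ∈ Finset.Icc 1 N ∧ p ≠ q ∧ X = {p, q} ∧ OpenAt p {p, q} := by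
  obtain ⟨i, j, hi, hij, hj, rfl⟩ := hB.exists_pair hX
  -- An even pair is traversed from `j` through `N` to `i`, an odd one from `i` to `j`.
  by_cases h : i % 2 = j % 2
  · refine ⟨j, i, Finset.mem_Icc.2 ⟨by omega, hj⟩, by omega, Finset.pair_comm i j, ?_⟩
    rw [Finset.pair_comm, openAt_pair hij]; omega
  · refine ⟨i, j, Finset.mem_Icc.2 ⟨hi, by omega⟩, by omega, rfl, ?_⟩
    rw [openAt_pair hij]; omega

/-- Arcs start exactly where the count rises, and an arc ends at the first later cut, cyclically,
where the count falls below the level reached at its start. -/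
lemma IsArcSystem.subset_of_openCount_eq (hB : IsArcSystem N B) (hC : IsArcSystem N C)
    (hN : Odd N) (h : ∀ k ≤ N, openCount B k = openCount C k) : B ⊆ C := by
  intro X hX
  obtain ⟨p, q, hpN, hpq, rfl, ho⟩ := hB.pairing.exists_arc hX
  have hp : 1 ≤ p ∧ p ≤ N := Finset.mem_Icc.1 hpN
  have hq : 1 ≤ q ∧ q ≤ N := Finset.mem_Icc.1 ((hB.pairing.1 _ hX).1 (by simp))
  obtain ⟨k, rfl⟩ : ∃ k, p = k + 1 := ⟨p - 1, by omega⟩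
  have hup := hB.pairing.openCount_succ_of_open hX (by simp) ho
  rw [h _ hp.2, h k (by omega)] at hup
  obtain ⟨Y, hY, hkY, hoY⟩ : ∃ Y ∈ C, k + 1 ∈ Y ∧ OpenAt (k + 1) Y := by
    by_cases hs : k + 1 ∈ supp C
    · obtain ⟨Y, hY, hkY⟩ := mem_supp.1 hs
      refine ⟨Y, hY, hkY, ?_⟩
      by_contra hno
      have := hC.pairing.openCount_succ_of_not_open hY hkY hno
      omega
    · have := hC.pairing.openCount_succ_of_notMem hs
      omega
  obtain ⟨r, hpr, rfl⟩ : ∃ r, k + 1 ≠ r ∧ Y = {k + 1, r} := by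
    obtain ⟨i, j, -, hij, -, rfl⟩ := hC.pairing.exists_pair hY
    simp only [Finset.mem_insert, Finset.mem_singleton] at hkY
    rcases hkY with rfl | rfl
    · exact ⟨j, by omega, rfl⟩
    · exact ⟨i, by omega, Finset.pair_comm i _⟩
  have hr : 1 ≤ r ∧ r ≤ N := Finset.mem_Icc.1 ((hC.pairing.1 _ hY).1 (by simp))
  have hBq := hB.openCount_lt hX hpq ho
  have hCr := hC.openCount_lt hY hpr hoY
  -- Under an arc the count stays at least at its starting level, and at the end it is smaller. So
  -- neither arc can end under the other.
  have h1 : ¬ Under (k + 1) r q := fun hu => by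
    have := hC.openCount_le hN hY hpr hoY hu
    rw [h _ hp.2, h _ hq.2] at hBq
    omega
  have h2 : ¬ Under (k + 1) q r := fun hu => by
    have := hB.openCount_le hN hX hpq ho hu
    rw [h _ hp.2, h _ hr.2] at this
    omega
  have : q = r := by unfold Under at h1 h2; omega
  rwa [this]

lemma IsArcSystem.eq_of_openCount_eq (hB : IsArcSystem N B) (hC : IsArcSystem N C)
    (hN : Odd N) (h : ∀ k ≤ N, openCount B k = openCount C k) : B = C :=
  (hB.subset_of_openCount_eq hC hN h).antisymm
    (hC.subset_of_openCount_eq hB hN fun k hk => (h k hk).symm)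

/-! ### The antiperiodic walk of a sign sequence -/

/-- The walk with steps `2 * y j` that changes its sign after `N` steps. -/
def walk (N : ℕ) (y : ℕ → ℤ) (k : ℕ) : ℤ :=
  ∑ j ∈ Finset.Icc 1 N, (if j ≤ k then 1 else -1) * y j

lemma walk_succ (y : ℕ → ℤ) {k : ℕ} (hk : k < N) :
    walk N y (k + 1) = walk N y k + 2 * y (k + 1) := by
  have hm : k + 1 ∈ Finset.Icc 1 N := Finset.mem_Icc.2 ⟨by omega, hk⟩
  unfold walk
  rw [← Finset.add_sum_erase _ _ hm, ← Finset.add_sum_erase _ _ hm]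
  have : ∑ j ∈ (Finset.Icc 1 N).erase (k + 1), (if j ≤ k + 1 then 1 else -1) * y j =
      ∑ j ∈ (Finset.Icc 1 N).erase (k + 1), (if j ≤ k then 1 else -1) * y j := by
    refine Finset.sum_congr rfl fun j hj => ?_
    have := Finset.ne_of_mem_erase hj
    congr 1
    exact if_congr (by omega) rfl rfl
  rw [this]
  simp
  ring

lemma walk_last (y : ℕ → ℤ) : walk N y N = - walk N y 0 := by
  unfold walk
  rw [← Finset.sum_neg_distrib]
  refine Finset.sum_congr rfl fun j hj => ?_
  rw [Finset.mem_Icc] at hj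
  rw [if_pos hj.2, if_neg (by omega)]
  ring

/-- The steps determine a walk up to a constant, and the sign change after `N` steps forces this
constant to vanish. -/
lemma walk_unique {y W : ℕ → ℤ} (hs : ∀ k < N, W (k + 1) = W k + 2 * y (k + 1))
    (hl : W N = - W 0) {k : ℕ} (hk : k ≤ N) : walk N y k = W k := by
  have hc : ∀ k ≤ N, W k - walk N y k = W 0 - walk N y 0 := by
    intro k
    induction k with
    | zero => intro _; rfl
    | succ k ih => intro h; rw [hs k h, walk_succ y h, ← ih (by omega)]; ring
  have h1 := hc k hk
  have h2 := hc N le_rfl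
  rw [walk_last, hl] at h2
  linarith

/-- The side of the origin on which the walk of `B` is at the cut after `k`. -/
def side (B : Finset (Finset ℕ)) (k : ℕ) : ℤ := (-1) ^ (k + openCount B k)

lemma abs_side (B : Finset (Finset ℕ)) (k : ℕ) : |side B k| = 1 := by
  rw [side, abs_pow]; simp

lemma IsPairing.side_last (hB : IsPairing N B) (hN : Odd N) : side B N = - side B 0 := by
  rw [side, side, hB.openCount_last, pow_add, pow_add, hN.neg_one_pow]
  simp

lemma IsPairing.side_succ_of_mem (hB : IsPairing N B) {k : ℕ} (hk : k + 1 ∈ supp B) :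
    side B (k + 1) = side B k := by
  obtain ⟨X, hX, hkX⟩ := mem_supp.1 hk
  unfold side
  by_cases ho : OpenAt (k + 1) X
  · rw [hB.openCount_succ_of_open hX hkX ho]; ring
  · rw [hB.openCount_succ_of_not_open hX hkX ho]; ring

lemma IsPairing.side_succ_of_notMem (hB : IsPairing N B) {k : ℕ} (hk : k + 1 ∉ supp B) :
    side B (k + 1) = - side B k := by
  unfold side
  rw [hB.openCount_succ_of_notMem hk]; ring

lemma IsArcSystem.side_of_notMem (hB : IsArcSystem N B) {u : ℕ} (huN : u ∈ Finset.Icc 1 N)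
    (hu : u ∉ supp B) : side B u = (-1) ^ u := by
  rw [side, hB.openCount_of_notMem huN hu, add_zero]

lemma IsArcSystem.walk_unmatched (hB : IsArcSystem N B) (hN : Odd N) {k : ℕ} (hk : k ≤ N) :
    walk N (fun j => if j ∈ supp B then 0 else (-1) ^ j) k = side B k := by
  refine walk_unique (fun k hk => ?_) (hB.pairing.side_last hN) hk
  by_cases hs : k + 1 ∈ supp B
  · simp [hs, hB.pairing.side_succ_of_mem hs]
  · have h1 := hB.pairing.side_succ_of_notMem hs
    have h2 : side B (k + 1) = (-1) ^ (k + 1) :=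
      hB.side_of_notMem (Finset.mem_Icc.2 ⟨by omega, hk⟩) hs
    simp only [hs, if_false]
    linarith

/-- The walk moves away from the origin where an arc starts and back towards it where an arc ends.
At an unmatched point no arc is open, and it crosses between `1` and `-1`. -/
lemma IsArcSystem.walk_depth (hB : IsArcSystem N B) (hN : Odd N) {k : ℕ} (hk : k ≤ N) :
    walk N (fun j => (-1) ^ j * (-1) ^ depth N B j) k = side B k * (1 + 2 * openCount B k) := by
  refine walk_unique (W := fun k => side B k * (1 + 2 * openCount B k)) (fun k hk => ?_) ?_ hk
  · by_cases hs : k + 1 ∈ supp B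
    · rw [← hB.pairing.side_succ_of_mem hs]
      obtain ⟨X, hX, hkX⟩ := mem_supp.1 hs
      by_cases ho : OpenAt (k + 1) X
      · rw [hB.pairing.depth_of_open hX hkX ho, ← pow_add, ← side,
          hB.pairing.openCount_succ_of_open hX hkX ho]
        push_cast; ring
      · rw [hB.pairing.depth_of_not_open hX hkX ho,
          hB.pairing.openCount_succ_of_not_open hX hkX ho, side]
        push_cast; ring
    · have h1 := hB.pairing.side_succ_of_notMem hs
      have hm : k + 1 ∈ Finset.Icc 1 N := Finset.mem_Icc.2 ⟨by omega, hk⟩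
      have h2 := hB.side_of_notMem hm hs
      rw [hB.depth_of_notMem hs, ← hB.pairing.openCount_succ_of_notMem hs,
        hB.openCount_of_notMem hm hs, ← h2]
      push_cast
      linarith
  · simp only [hB.pairing.side_last hN, hB.pairing.openCount_last]
    ring

/-- With a common sign `d`, the two terms cancel when the arc misses the cut: an odd pair then lies
on one side of the cut, an even pair is separated by it. -/
lemma IsPairing.abs_walk_pair_le (hB : IsPairing N B) {X : Finset ℕ} (hX : X ∈ B) {d : ℕ → ℤ}
    (hd : ∀ j, |d j| = 1) (hc : ∀ i ∈ X, ∀ j ∈ X, d i = d j) (k : ℕ) :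
    |∑ j ∈ X, (if j ≤ k then 1 else -1) * ((-1) ^ j * d j)| ≤ if OpenAt k X then 2 else 0 := by
  obtain ⟨i, j, -, hij, -, rfl⟩ := hB.exists_pair hX
  rw [Finset.sum_pair hij.ne, ← hc i (by simp) j (by simp)]
  have hdi : |d i| ≤ 1 := (hd i).le
  rw [abs_le] at hdi
  have hp : (-1 : ℤ) ^ i = if i % 2 = 0 then 1 else -1 := by
    split_ifs with h
    · exact (Nat.even_iff.2 h).neg_one_pow
    · exact (Nat.odd_iff.2 (by omega)).neg_one_pow
  have hq : (-1 : ℤ) ^ j = if j % 2 = 0 then 1 else -1 := by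
    split_ifs with h
    · exact (Nat.even_iff.2 h).neg_one_pow
    · exact (Nat.odd_iff.2 (by omega)).neg_one_pow
  rw [hp, hq, abs_le]
  simp only [openAt_pair hij]
  split_ifs <;> constructor <;> omega

/-- The walk of a sign sequence compatible with the pairs of `C` is bounded by that of `C`. -/
lemma IsArcSystem.abs_walk_le (hC : IsArcSystem N C) (hN : Odd N) {d : ℕ → ℤ}
    (hd : ∀ j, |d j| = 1) (hc : ∀ X ∈ C, ∀ i ∈ X, ∀ j ∈ X, d i = d j)
    (hu : ∀ u ∈ Finset.Icc 1 N, u ∉ supp C → d u = 1) {k : ℕ} (hk : k ≤ N) :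
    |walk N (fun j => (-1) ^ j * d j) k| ≤ 1 + 2 * openCount C k := by
  -- Where `d = 1` the unmatched terms are those of the walk in `IsArcSystem.walk_unmatched`.
  have hU : ∑ j ∈ Finset.Icc 1 N \ supp C, (if j ≤ k then 1 else -1) * ((-1) ^ j * d j) =
      side C k := by
    rw [← hC.walk_unmatched hN hk, walk, ← Finset.sum_sdiff hC.pairing.supp_subset]
    rw [Finset.sum_eq_zero (s := supp C), add_zero]
    · refine Finset.sum_congr rfl fun j hj => ?_
      rw [Finset.mem_sdiff] at hj
      rw [if_neg hj.2, hu j hj.1 hj.2, mul_one]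
    · intro j hj
      rw [if_pos hj, mul_zero]
  rw [walk, hC.pairing.sum_split, hU]
  refine (abs_add_le _ _).trans ?_
  rw [abs_side]
  gcongr
  refine (Finset.abs_sum_le_sum_abs _ _).trans ?_
  refine (Finset.sum_le_sum fun X hX => hC.pairing.abs_walk_pair_le hX hd (hc X hX) k).trans ?_
  rw [← Finset.sum_filter, Finset.sum_const, openCount]
  simp [mul_comm]

/-! ### The relation on `𝒳_{N-1}` -/

lemma eps_apply (k : Finset.Icc 1 N) : eps N B k = (depth N B k : ZMod 2) := by
  simp only [eps, Finset.sum_apply, ind, depth, Finset.card_filter]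
  push_cast
  rfl

lemma IsPairing.apply_eq_of_mem_spanB (hB : IsPairing N B) {v : Vec N} (hv : v ∈ spanB N B) :
    (∀ X ∈ B, ∀ i j : Finset.Icc 1 N, (i : ℕ) ∈ X → (j : ℕ) ∈ X → v i = v j) ∧
      ∀ u : Finset.Icc 1 N, (u : ℕ) ∉ supp B → v u = 0 := by
  refine Submodule.span_induction ?_ ?_ ?_ ?_ hv
  · rintro _ ⟨Y, hY, rfl⟩
    refine ⟨fun X hX i j hi hj => ?_, fun u hu => ?_⟩
    · unfold ind
      refine if_congr ⟨fun h => ?_, fun h => ?_⟩ rfl rfl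
      · rwa [hB.eq_of_mem hY hX h hi]
      · rwa [hB.eq_of_mem hY hX h hj]
    · exact if_neg fun h => hu (mem_supp.2 ⟨Y, hY, h⟩)
  · simp
  · rintro x y - - ⟨hx, hx'⟩ ⟨hy, hy'⟩
    refine ⟨fun X hX i j hi hj => ?_, fun u hu => ?_⟩
    · simp [hx X hX i j hi hj, hy X hX i j hi hj]
    · simp [hx' u hu, hy' u hu]
  · rintro a x - ⟨hx, hx'⟩
    refine ⟨fun X hX i j hi hj => ?_, fun u hu => ?_⟩
    · simp [hx X hX i j hi hj]
    · simp [hx' u hu]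

lemma neg_one_pow_eq_of_zmod {a b : ℕ} (h : (a : ZMod 2) = b) : (-1 : ℤ) ^ a = (-1) ^ b := by
  rw [ZMod.natCast_eq_natCast_iff] at h
  exact neg_one_pow_congr (by rw [Nat.even_iff, Nat.even_iff, h])

/-- One walk is evaluated twice: exactly from the arcs of `B`, and as a bound from those of `C`. -/
lemma IsArcSystem.openCount_le_of_eps_mem (hB : IsArcSystem N B) (hC : IsArcSystem N C)
    (hN : Odd N) (h : eps N B ∈ spanB N C) {k : ℕ} (hk : k ≤ N) :
    openCount B k ≤ openCount C k := by
  obtain ⟨h1, h2⟩ := hC.pairing.apply_eq_of_mem_spanB h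
  simp only [eps_apply] at h1 h2
  have hw := hC.abs_walk_le hN (d := fun j => (-1) ^ depth N B j)
    (fun j => by rw [abs_pow]; simp)
    (fun X hX i hi j hj => neg_one_pow_eq_of_zmod
      (h1 X hX ⟨i, (hC.pairing.1 X hX).1 hi⟩ ⟨j, (hC.pairing.1 X hX).1 hj⟩ hi hj))
    (fun u hu hs => by
      simpa using neg_one_pow_eq_of_zmod (b := 0) (by simpa using h2 ⟨u, hu⟩ hs)) hk
  rw [hB.walk_depth hN hk, abs_mul, abs_side, one_mul, abs_of_nonneg (by positivity)] at hw
  omega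

end ArcSystem

section Covered

variable {N : ℕ} {B C : Finset (Finset ℕ)}

/-! ### Covered sets -/

lemma Covered0.mono {S : Finset ℕ} (h : Covered0 B S) (hBC : B ⊆ C) : Covered0 C S := by
  obtain ⟨T, h1, h2, h3⟩ := h
  exact ⟨T, fun p hp => ⟨(h1 p hp).1, Finset.filter_subset_filter _ hBC (h1 p hp).2⟩, h2, h3⟩

lemma covered0_empty : Covered0 B ∅ := ⟨∅, by simp, by simp, by simp⟩

lemma covered0_Icc {a b : ℕ} (h : a < b) (hab : {a, b} ∈ odd B) :
    Covered0 B (Finset.Icc a b) :=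
  ⟨{(a, b)}, by simp [h, hab], by simp, by simp⟩

lemma Covered0.union {S S' : Finset ℕ} (h : Covered0 B S) (h' : Covered0 B S')
    (hd : Disjoint S S') : Covered0 B (S ∪ S') := by
  obtain ⟨T, h1, h2, rfl⟩ := h
  obtain ⟨T', h1', h2', rfl⟩ := h'
  rw [Finset.disjoint_biUnion_left] at hd
  simp only [Finset.disjoint_biUnion_right] at hd
  refine ⟨T ∪ T', ?_, ?_, Finset.union_biUnion.symm⟩
  · intro p hp
    rcases Finset.mem_union.1 hp with hp | hp
    exacts [h1 p hp, h1' p hp]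
  · intro p hp q hq hpq
    rcases Finset.mem_union.1 hp with hp | hp <;> rcases Finset.mem_union.1 hq with hq | hq
    exacts [h2 p hp q hq hpq, hd p hp q hq, (hd q hq p hp).symm, h2' p hp q hq hpq]

/-- A condition constant on intervals keeps or drops each covering interval as a whole. This serves
to split a set at an exceptional point. -/
lemma Covered0.filter {S : Finset ℕ} (h : Covered0 B S) (P : ℕ → Prop) [DecidablePred P]
    (hP : ∀ a b, a ≤ b → Finset.Icc a b ⊆ S → ∀ k ∈ Finset.Icc a b, P k ↔ P a) :
    Covered0 B (S.filter P) := by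
  obtain ⟨T, h1, h2, rfl⟩ := h
  refine ⟨T.filter (fun p => P p.1), fun p hp => h1 p (Finset.mem_filter.1 hp).1,
    fun p hp q hq => h2 p (Finset.mem_filter.1 hp).1 q (Finset.mem_filter.1 hq).1, ?_⟩
  ext k
  simp only [Finset.mem_filter, Finset.mem_biUnion]
  constructor
  · rintro ⟨⟨p, hp, hk⟩, hPk⟩
    exact ⟨p, ⟨hp, (hP p.1 p.2 (h1 p hp).1.le
      (Finset.subset_biUnion_of_mem (fun p : ℕ × ℕ => Finset.Icc p.1 p.2) hp) k hk).1 hPk⟩, hk⟩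
  · rintro ⟨p, ⟨hp, hPp⟩, hk⟩
    exact ⟨⟨p, hp, hk⟩, (hP p.1 p.2 (h1 p hp).1.le
      (Finset.subset_biUnion_of_mem (fun p : ℕ × ℕ => Finset.Icc p.1 p.2) hp) k hk).2 hPp⟩

lemma Covered0.filter_lt {S : Finset ℕ} (h : Covered0 B S) {u : ℕ} (hu : u ∉ S) :
    Covered0 B (S.filter (· < u)) := by
  refine h.filter _ fun a b hab hS k hk => ?_
  have : u ∉ Finset.Icc a b := fun hm => hu (hS hm)
  rw [Finset.mem_Icc] at this hk
  omega

lemma Covered0.filter_gt {S : Finset ℕ} (h : Covered0 B S) {u : ℕ} (hu : u ∉ S) :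
    Covered0 B (S.filter (u < ·)) := by
  refine h.filter _ fun a b hab hS k hk => ?_
  have : u ∉ Finset.Icc a b := fun hm => hu (hS hm)
  rw [Finset.mem_Icc] at this hk
  omega

lemma Covered0.even_card {S : Finset ℕ} (h : Covered0 B S) : Even S.card := by
  obtain ⟨T, h1, h2, rfl⟩ := h
  rw [Finset.card_biUnion h2]
  refine Finset.even_sum _ fun p hp => ?_
  obtain ⟨hlt, hodd⟩ := h1 p hp
  have := (Finset.mem_filter.1 hodd).2
  rw [sameParity_pair] at this
  rw [Nat.card_Icc, Nat.even_iff]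
  omega

/-! ### Saturated sets -/

lemma saturated_of_mem {X : Finset ℕ} (hX : X ∈ B) : Saturated B X :=
  fun _ hk => ⟨X, hX, hk, Finset.Subset.refl X⟩

lemma Saturated.union {S S' : Finset ℕ} (h : Saturated B S) (h' : Saturated B S') :
    Saturated B (S ∪ S') := by
  intro k hk
  rcases Finset.mem_union.1 hk with hk | hk
  · obtain ⟨Y, hY, hkY, hYS⟩ := h k hk
    exact ⟨Y, hY, hkY, hYS.trans Finset.subset_union_left⟩
  · obtain ⟨Y, hY, hkY, hYS⟩ := h' k hk
    exact ⟨Y, hY, hkY, hYS.trans Finset.subset_union_right⟩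

lemma Covered0.saturated_of {S : Finset ℕ} (hS : Covered0 B S)
    (h : ∀ a b, a < b → {a, b} ∈ odd B → Finset.Icc a b ⊆ S → Saturated B (Finset.Icc a b)) :
    Saturated B S := by
  obtain ⟨T, h1, -, rfl⟩ := hS
  intro k hk
  obtain ⟨p, hp, hkp⟩ := Finset.mem_biUnion.1 hk
  have hs := Finset.subset_biUnion_of_mem (fun p : ℕ × ℕ => Finset.Icc p.1 p.2) hp
  obtain ⟨Y, hY, hkY, hYs⟩ := h p.1 p.2 (h1 p hp).1 (h1 p hp).2 hs k hkp
  exact ⟨Y, hY, hkY, hYs.trans hs⟩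

lemma IsStar.saturated_Icc (hB : IsStar N B) {a b : ℕ} (hab : a < b) (hX : {a, b} ∈ odd B) :
    Saturated B (Finset.Icc a b) := by
  induction hn : b - a using Nat.strong_induction_on generalizing a b with
  | _ n ih =>
    have h1 : Saturated B (Finset.Ioo a b) := by
      refine (hB.2.1 a b hab hX).saturated_of fun c d hcd hY hs => ih (d - c) ?_ hcd hY rfl
      have hc := Finset.mem_Ioo.1 (hs (Finset.left_mem_Icc.2 hcd.le))
      have hd := Finset.mem_Ioo.1 (hs (Finset.right_mem_Icc.2 hcd.le))
      omega
    have h2 := h1.union (saturated_of_mem (Finset.mem_filter.1 hX).1)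
    convert h2 using 1
    ext k
    simp only [Finset.mem_Icc, Finset.mem_union, Finset.mem_Ioo, Finset.mem_insert,
      Finset.mem_singleton]
    omega

lemma IsStar.saturated (hB : IsStar N B) {S : Finset ℕ} (hS : Covered0 B S) : Saturated B S :=
  hS.saturated_of fun _ _ hab hX _ => hB.saturated_Icc hab hX

/-! ### The sequence of the even pairs -/

lemma IsSeq.lt {s : ℕ} {i : ℕ → ℕ} (h : IsSeq B s i) {k l : ℕ} (hk : 1 ≤ k) (hkl : k < l)
    (hl : l ≤ 2 * s) : i k < i l :=
  h.1 (Set.mem_Icc.2 ⟨hk, by omega⟩) (Set.mem_Icc.2 ⟨by omega, hl⟩) hkl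

lemma IsSeq.le {s : ℕ} {i : ℕ → ℕ} (h : IsSeq B s i) {k l : ℕ} (hk : 1 ≤ k) (hkl : k ≤ l)
    (hl : l ≤ 2 * s) : i k ≤ i l :=
  h.1.monotoneOn (Set.mem_Icc.2 ⟨hk, by omega⟩) (Set.mem_Icc.2 ⟨by omega, hl⟩) hkl

lemma IsSeq.pair_mem {s : ℕ} {i : ℕ → ℕ} (h : IsSeq B s i) {k : ℕ} (hk : 1 ≤ k) (hks : k ≤ s) :
    {i (2 * s + 1 - k), i k} ∈ even B := by
  rw [h.2.1]
  exact Finset.mem_image.2 ⟨k, Finset.mem_Icc.2 ⟨hk, hks⟩, rfl⟩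

lemma IsSeq.subset_Icc {s : ℕ} {i : ℕ → ℕ} (h : IsSeq B s i) {Y : Finset ℕ} (hY : Y ∈ even B) :
    Y ⊆ Finset.Icc (i 1) (i (2 * s)) := by
  rw [h.2.1] at hY
  obtain ⟨k, hk, rfl⟩ := Finset.mem_image.1 hY
  rw [Finset.mem_Icc] at hk
  intro x hx
  simp only [Finset.mem_insert, Finset.mem_singleton] at hx
  rw [Finset.mem_Icc]
  rcases hx with rfl | rfl <;> exact ⟨h.le (by omega) (by omega) (by omega),
    h.le (by omega) (by omega) (by omega)⟩

lemma IsSeq.card_even {s : ℕ} {i : ℕ → ℕ} (h : IsSeq B s i) : (even B).card = s := by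
  rw [h.2.1, Finset.card_image_of_injOn, Nat.card_Icc, Nat.add_sub_cancel]
  intro k hk l hl hkl
  simp only [Finset.coe_Icc, Set.mem_Icc] at hk hl
  have hm : i k ∈ ({i (2 * s + 1 - l), i l} : Finset ℕ) := by
    have hkl' : ({i (2 * s + 1 - k), i k} : Finset ℕ) = {i (2 * s + 1 - l), i l} := hkl
    rw [← hkl']; simp
  simp only [Finset.mem_insert, Finset.mem_singleton] at hm
  rcases hm with hm | hm
  · have := h.lt (k := k) (l := 2 * s + 1 - l) hk.1 (by omega) (by omega)
    omega
  · exact h.1.injOn (Set.mem_Icc.2 ⟨hk.1, by omega⟩) (Set.mem_Icc.2 ⟨hl.1, by omega⟩) hm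

lemma isSeq_zero (h : (even B).card = 0) : IsSeq B 0 id :=
  ⟨strictMono_id.strictMonoOn _, by simpa using h, fun k h1 h2 => by omega⟩

/-- The arc of an even pair runs around the outside. It grows inwards with `k`, each time by two
covered gaps and one more pair. -/
lemma IsStar.saturated_outer (hB : IsStar N B) {s : ℕ} {i : ℕ → ℕ} (h : IsSeq B s i)
    (h1 : Covered0 B (Finset.Ico 1 (i 1))) (h2 : Covered0 B (Finset.Ioc (i (2 * s)) N))
    {k : ℕ} (hk : 1 ≤ k) (hks : k ≤ s) :
    Saturated B (Finset.Icc 1 (i k) ∪ Finset.Icc (i (2 * s + 1 - k)) N) := by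
  induction k, hk using Nat.le_induction with
  | base =>
    have hm := (Finset.mem_filter.1 (h.pair_mem le_rfl hks)).1
    have hb := (hB.1.1 _ hm).1
    rw [Finset.insert_subset_iff, Finset.singleton_subset_iff, Finset.mem_Icc,
      Finset.mem_Icc] at hb
    convert ((hB.saturated h1).union (hB.saturated h2)).union (saturated_of_mem hm) using 1
    ext x
    simp only [Finset.mem_Icc, Finset.mem_union, Finset.mem_Ico, Finset.mem_Ioc,
      Finset.mem_insert, Finset.mem_singleton, Nat.add_sub_cancel] at hb ⊢
    omega
  | succ k hk ih =>
    have hm := (Finset.mem_filter.1 (h.pair_mem (k := k + 1) (by omega) hks)).1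
    have hb := (hB.1.1 _ hm).1
    rw [Finset.insert_subset_iff, Finset.singleton_subset_iff, Finset.mem_Icc,
      Finset.mem_Icc] at hb
    have g1 := hB.saturated (h.2.2 k hk (by omega) (by omega))
    have g2 := hB.saturated (h.2.2 (2 * s + 1 - (k + 1)) (by omega) (by omega) (by omega))
    have hN := (Finset.mem_Icc.1 ((hB.1.1 _ (Finset.mem_filter.1
      (h.pair_mem (k := k) hk (by omega))).1).1 (Finset.mem_insert_self _ _))).2
    have e : 2 * s + 1 - (k + 1) + 1 = 2 * s + 1 - k := by omega
    rw [e] at g2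
    have l1 := h.lt (k := k) (l := k + 1) hk (by omega) (by omega)
    have l2 := h.lt (k := 2 * s + 1 - (k + 1)) (l := 2 * s + 1 - k)
      (by omega) (by omega) (by omega)
    convert (((ih (by omega)).union g1).union g2).union (saturated_of_mem hm) using 1
    ext x
    simp only [Finset.mem_Icc, Finset.mem_union, Finset.mem_Ioo,
      Finset.mem_insert, Finset.mem_singleton] at hb ⊢
    omega

lemma isArcSystem_of_mem_X1 (hB : B ∈ X1 N) : IsArcSystem N B := by
  obtain ⟨hB, s, i, hi, hs⟩ := hB
  refine ⟨hB.1, fun X hX => ?_⟩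
  by_cases hp : SameParity X
  · have hXe : X ∈ even B := Finset.mem_filter.2 ⟨hX, hp⟩
    have hXi := hXe
    rw [hi.2.1] at hXi
    obtain ⟨k, hk, rfl⟩ := Finset.mem_image.1 hXi
    rw [Finset.mem_Icc] at hk
    obtain ⟨-, h1, h2⟩ := hs.resolve_left (by omega)
    have hb := (hB.1.1 _ hX).1
    rw [Finset.insert_subset_iff, Finset.singleton_subset_iff, Finset.mem_Icc,
      Finset.mem_Icc] at hb
    have hlt := hi.lt (k := k) (l := 2 * s + 1 - k) hk.1 (by omega) (by omega)
    convert hB.saturated_outer hi h1 h2 hk.1 hk.2 using 1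
    ext x
    rw [sameParity_pair] at hp
    rw [Finset.pair_comm, mem_bracket_pair hlt]
    simp only [Finset.mem_Icc, Finset.mem_union]
    omega
  · have hXo : X ∈ odd B := Finset.mem_filter.2 ⟨hX, hp⟩
    obtain ⟨a, b, ha, hab, hb, rfl⟩ := hB.1.exists_pair hX
    convert hB.saturated_Icc hab hXo using 1
    ext x
    rw [sameParity_pair] at hp
    rw [mem_bracket_pair hab, Finset.mem_Icc]
    omega

/-! ### The exceptional point -/

lemma exists_isExc (hB : B ∈ X2plus N) (h0 : (even B).card ≠ 0) : ∃ u, IsExc N B u := by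
  obtain ⟨-, -, s, i, hi, hs⟩ := hB
  obtain ⟨hs, hc⟩ := hs.resolve_left (by rw [← hi.card_even]; exact h0)
  rcases hc with hc | hc
  · obtain ⟨u, hu, hcov⟩ := hc.1
    refine ⟨u, s, i, hi, hs, Or.inl ⟨hc, hu, ?_, ?_⟩⟩
    · convert hcov.filter_lt (Finset.notMem_erase u _) using 1
      ext k
      simp only [Finset.mem_Ico, Finset.mem_filter, Finset.mem_erase] at hu ⊢
      omega
    · convert hcov.filter_gt (Finset.notMem_erase u _) using 1
      ext k
      simp only [Finset.mem_Ico, Finset.mem_Ioo, Finset.mem_filter, Finset.mem_erase] at hu ⊢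
      omega
  · obtain ⟨u, hu, hcov⟩ := hc.2
    refine ⟨u, s, i, hi, hs, Or.inr ⟨hc, hu, ?_, ?_⟩⟩
    · convert hcov.filter_lt (Finset.notMem_erase u _) using 1
      ext k
      simp only [Finset.mem_Ioo, Finset.mem_filter, Finset.mem_erase] at hu ⊢
      omega
    · convert hcov.filter_gt (Finset.notMem_erase u _) using 1
      ext k
      simp only [Finset.mem_Ioo, Finset.mem_filter, Finset.mem_erase] at hu ⊢
      omega

/-- Uniqueness of the exceptional point is never needed: any point with this property will do. -/
lemma isExc_exc (hB : B ∈ X2plus N) (h0 : (even B).card ≠ 0) : IsExc N B (exc N B) := by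
  have h := exists_isExc hB h0
  rw [exc, dif_pos h]
  exact h.choose_spec

/-- A pair containing `u` would be odd with its other end strictly between `p` and `q`. Its interval
would contain exactly one of `p`, `q`, although it is saturated. -/
lemma IsStar.notMem_supp (hB : IsStar N B) (hN : N ∉ supp B) {p q u : ℕ} (hpq : p < q)
    (hX : {p, q} ∈ B) (heven : ∀ Y ∈ even B, Y ⊆ Finset.Icc p q) (hu : u < p ∨ q < u)
    {S : Finset ℕ} (hS : Saturated B S) (huS : u ∉ S)
    (hcov : ∀ x ∈ Finset.Icc 1 N, x ∈ S ∨ x = u ∨ x = N ∨ (p ≤ x ∧ x ≤ q)) : u ∉ supp B := by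
  intro hus
  obtain ⟨Y, hY, huY⟩ := mem_supp.1 hus
  have hYS : ∀ x ∈ Y, x ∉ S := fun x hx hxS => huS (hS.subset hB.1 hY hx hxS huY)
  have hYN : ∀ x ∈ Y, x ≠ N := fun x hx hxN => hN (mem_supp.2 ⟨Y, hY, hxN ▸ hx⟩)
  have hpX : p ∈ ({p, q} : Finset ℕ) := by simp
  have hqX : q ∈ ({p, q} : Finset ℕ) := by simp
  have hYX : Y ≠ {p, q} := by
    rintro rfl
    simp only [Finset.mem_insert, Finset.mem_singleton] at huY
    omega
  have hpY := hB.1.notMem_of_ne hX hY hYX hpX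
  have hqY := hB.1.notMem_of_ne hX hY hYX hqX
  have hodd : Y ∈ odd B := by
    refine Finset.mem_filter.2 ⟨hY, fun hp => ?_⟩
    have := Finset.mem_Icc.1 (heven Y (Finset.mem_filter.2 ⟨hY, hp⟩) huY)
    omega
  obtain ⟨a, b, ha, hab, hb, rfl⟩ := hB.1.exists_pair hY
  have haY : a ∈ ({a, b} : Finset ℕ) := by simp
  have hbY : b ∈ ({a, b} : Finset ℕ) := by simp
  have ha' := (hcov a (Finset.mem_Icc.2 ⟨ha, by omega⟩)).resolve_left (hYS a haY)
  have hb' := (hcov b (Finset.mem_Icc.2 ⟨by omega, hb⟩)).resolve_left (hYS b hbY)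
  have haN := hYN a haY
  have hbN := hYN b hbY
  have hsat := hB.saturated_Icc hab hodd
  simp only [Finset.mem_insert, Finset.mem_singleton, not_or] at hpY hqY huY
  have hp' := fun h => Finset.mem_Icc.1 (hsat.subset hB.1 hX hpX h hqX)
  have hq' := fun h => Finset.mem_Icc.1 (hsat.subset hB.1 hX hqX h hpX)
  rw [Finset.mem_Icc] at hp' hq'
  omega

lemma IsPairing.insert_pair (hB : IsPairing N B) {u : ℕ} (hu1 : 1 ≤ u) (huN : u < N)
    (hu : u ∉ supp B) (hN : N ∉ supp B) : IsPairing N (insert {u, N} B) := by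
  have hd : ∀ Y ∈ B, Disjoint ({u, N} : Finset ℕ) Y := by
    intro Y hY
    rw [Finset.disjoint_insert_left, Finset.disjoint_singleton_left]
    exact ⟨fun h => hu (mem_supp.2 ⟨Y, hY, h⟩), fun h => hN (mem_supp.2 ⟨Y, hY, h⟩)⟩
  refine ⟨fun X hX => ?_, fun X hX Y hY hXY => ?_⟩
  · rcases Finset.mem_insert.1 hX with rfl | hX
    · refine ⟨?_, Finset.card_pair huN.ne⟩
      intro x hx
      simp only [Finset.mem_insert, Finset.mem_singleton] at hx
      rw [Finset.mem_Icc]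
      omega
    · exact hB.1 X hX
  · rcases Finset.mem_insert.1 hX with rfl | hX' <;> rcases Finset.mem_insert.1 hY with rfl | hY'
    exacts [absurd rfl hXY, hd Y hY', (hd X hX').symm, hB.2 X hX' Y hY' hXY]

/-- In case (i) `u` is odd like `N`, so `{u, N}` becomes the outermost even pair. -/
lemma IsStar.insert_left (hB : IsStar N B) (hNodd : Odd N) (hN : N ∉ supp B) {s : ℕ} {i : ℕ → ℕ}
    (hi : IsSeq B s i) (hs : 1 ≤ s) {u : ℕ} (hu : u ∈ Finset.Ico 1 (i 1))
    (h1 : Covered0 B (Finset.Ico 1 u)) (h2 : Covered0 B (Finset.Ioo u (i 1)))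
    (h3 : Covered0 B (Finset.Ioo (i (2 * s)) N)) :
    u < N ∧ Odd u ∧ insert {u, N} B ∈ X1 N ∧ (even (insert {u, N} B)).card = s + 1 := by
  rw [Finset.mem_Ico] at hu
  have hX := (Finset.mem_filter.1 (hi.pair_mem le_rfl hs)).1
  rw [Nat.add_sub_cancel, Finset.pair_comm] at hX
  have hlt := hi.lt (k := 1) (l := 2 * s) le_rfl (by omega) le_rfl
  have hle : i (2 * s) ≤ N := (Finset.mem_Icc.1 ((hB.1.1 _ hX).1 (by simp))).2
  have hne : i (2 * s) ≠ N := fun h => hN (mem_supp.2 ⟨_, hX, by simp [h]⟩)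
  have huN : u < N := by omega
  have hus : u ∉ supp B := by
    refine hB.notMem_supp hN hlt hX (fun Y hY => hi.subset_Icc hY) (Or.inl hu.2)
      (((hB.saturated h1).union (hB.saturated h2)).union (hB.saturated h3)) ?_ ?_
    · simp only [Finset.mem_union, Finset.mem_Ico, Finset.mem_Ioo]
      omega
    · intro x
      simp only [Finset.mem_union, Finset.mem_Ico, Finset.mem_Ioo, Finset.mem_Icc]
      omega
  have huodd : Odd u := by
    have := h1.even_card
    rw [Nat.card_Ico, Nat.even_iff] at this
    rw [Nat.odd_iff]
    omega
  have hp : SameParity {u, N} := by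
    rw [sameParity_pair, Nat.odd_iff.1 huodd, Nat.odd_iff.1 hNodd]
  have hsub : B ⊆ insert {u, N} B := Finset.subset_insert _ _
  -- The new sequence is `u, i 1, …, i (2 * s), N`, so old indices shift by one.
  have hseq : IsSeq (insert {u, N} B) (s + 1)
      (fun k => if k ≤ 1 then u else if k ≤ 2 * s + 1 then i (k - 1) else N) := by
    refine ⟨?_, ?_, ?_⟩
    · intro k hk l hl hkl
      rw [Set.mem_Icc] at hk hl
      simp only
      have hk1 : 2 ≤ k → k ≤ 2 * s + 1 → i 1 ≤ i (k - 1) ∧ i (k - 1) ≤ i (2 * s) :=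
        fun h h' => ⟨hi.le le_rfl (by omega) (by omega), hi.le (by omega) (by omega) le_rfl⟩
      have hl1 : 2 ≤ l → l ≤ 2 * s + 1 → i 1 ≤ i (l - 1) :=
        fun h h' => hi.le le_rfl (by omega) (by omega)
      have hkl1 : 2 ≤ k → l ≤ 2 * s + 1 → i (k - 1) < i (l - 1) :=
        fun h h' => hi.lt (by omega) (by omega) (by omega)
      split_ifs <;> omega
    · have he : even (insert {u, N} B) = insert {u, N} (even B) := by
        rw [even, Finset.filter_insert, if_pos hp, even]
      have hI : Finset.Icc 1 (s + 1) = insert 1 ((Finset.Icc 1 s).image (· + 1)) := by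
        ext k
        simp only [Finset.mem_Icc, Finset.mem_insert, Finset.mem_image]
        constructor
        · intro h
          by_cases h1 : k = 1
          · exact Or.inl h1
          · exact Or.inr ⟨k - 1, by omega, by omega⟩
        · rintro (rfl | ⟨l, hl, rfl⟩) <;> omega
      rw [he, hi.2.1, hI, Finset.image_insert, Finset.image_image]
      congr 1
      · simp only
        rw [if_neg (by omega), if_neg (by omega), if_pos le_rfl, Finset.pair_comm]
      · refine Finset.image_congr fun k hk => ?_
        simp only [Finset.coe_Icc, Set.mem_Icc] at hk
        simp only [Function.comp_apply]
        rw [if_neg (by omega), if_pos (by omega), if_neg (by omega), if_pos (by omega)]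
        congr 2
        omega
    · intro k hk1 hk2 hks
      simp only
      rw [if_neg (show ¬ k + 1 ≤ 1 by omega)]
      by_cases hk : k = 1
      · subst hk
        rw [if_pos le_rfl, if_pos (by omega)]
        exact h2.mono hsub
      · rw [if_neg (by omega), if_pos (by omega), Nat.add_sub_cancel]
        by_cases hk' : k = 2 * s + 1
        · subst hk'
          rw [if_neg (by omega), Nat.add_sub_cancel]
          exact h3.mono hsub
        · rw [if_pos (by omega)]
          have := hi.2.2 (k - 1) (by omega) (by omega) (by omega)
          rw [Nat.sub_add_cancel hk1] at this
          exact this.mono hsub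
  refine ⟨huN, huodd, ⟨⟨hB.1.insert_pair hu.1 huN hus hN, ?_, _, _, hseq⟩, _, _, hseq,
    Or.inr ⟨by omega, ?_, ?_⟩⟩, hseq.card_even⟩
  · intro a b hab h
    rw [odd, Finset.filter_insert, if_neg (by simpa using hp)] at h
    exact (hB.2.1 a b hab h).mono hsub
  · rw [if_pos le_rfl]
    exact h1.mono hsub
  · rw [if_neg (by omega), if_neg (by omega), Finset.Ioc_self]
    exact covered0_empty

/-- In case (ii) `u` is even, so `{u, N}` is an odd pair. The even pairs stay the same, and `[u, N]`
completes the covering on the right. -/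
lemma IsStar.insert_right (hB : IsStar N B) (hNodd : Odd N) (hN : N ∉ supp B) {s : ℕ}
    {i : ℕ → ℕ} (hi : IsSeq B s i) (hs : 1 ≤ s) {u : ℕ} (hu : u ∈ Finset.Ioo (i (2 * s)) N)
    (h1 : Covered0 B (Finset.Ico 1 (i 1))) (h2 : Covered0 B (Finset.Ioo (i (2 * s)) u))
    (h3 : Covered0 B (Finset.Ioo u N)) :
    1 ≤ u ∧ Even u ∧ insert {u, N} B ∈ X1 N ∧ (even (insert {u, N} B)).card = s := by
  rw [Finset.mem_Ioo] at hu
  have hX := (Finset.mem_filter.1 (hi.pair_mem le_rfl hs)).1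
  rw [Nat.add_sub_cancel, Finset.pair_comm] at hX
  have hlt := hi.lt (k := 1) (l := 2 * s) le_rfl (by omega) le_rfl
  have hus : u ∉ supp B := by
    refine hB.notMem_supp hN hlt hX (fun Y hY => hi.subset_Icc hY) (Or.inr hu.1)
      (((hB.saturated h1).union (hB.saturated h2)).union (hB.saturated h3)) ?_ ?_
    · simp only [Finset.mem_union, Finset.mem_Ico, Finset.mem_Ioo]
      omega
    · intro x
      simp only [Finset.mem_union, Finset.mem_Ico, Finset.mem_Ioo, Finset.mem_Icc]
      omega
  have hueven : Even u := by
    have := h3.even_card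
    rw [Nat.card_Ioo, Nat.even_iff] at this
    rw [Nat.odd_iff] at hNodd
    rw [Nat.even_iff]
    omega
  have hp : ¬ SameParity {u, N} := by
    rw [sameParity_pair, Nat.even_iff.1 hueven, Nat.odd_iff.1 hNodd]
    omega
  have hsub : B ⊆ insert {u, N} B := Finset.subset_insert _ _
  have he : even (insert {u, N} B) = even B := by
    rw [even, Finset.filter_insert, if_neg hp, even]
  have hseq : IsSeq (insert {u, N} B) s i :=
    ⟨hi.1, he.trans hi.2.1, fun k hk1 hk2 hks => (hi.2.2 k hk1 hk2 hks).mono hsub⟩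
  have ho : {u, N} ∈ odd (insert {u, N} B) :=
    Finset.mem_filter.2 ⟨Finset.mem_insert_self _ _, hp⟩
  refine ⟨by omega, hueven, ⟨⟨hB.1.insert_pair (by omega) hu.2 hus hN, ?_, _, _, hseq⟩, _, _,
    hseq, Or.inr ⟨hs, h1.mono hsub, ?_⟩⟩, hseq.card_even⟩
  · intro a b hab h
    rw [odd, Finset.filter_insert, if_pos hp, Finset.mem_insert] at h
    rcases h with h | h
    · have ha : a ∈ ({u, N} : Finset ℕ) := by rw [← h]; simp
      have hb : b ∈ ({u, N} : Finset ℕ) := by rw [← h]; simp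
      simp only [Finset.mem_insert, Finset.mem_singleton] at ha hb
      obtain ⟨rfl, rfl⟩ : a = u ∧ b = N := by omega
      exact h3.mono hsub
    · exact (hB.2.1 a b hab h).mono hsub
  · convert (h2.mono hsub).union (covered0_Icc hu.2 ho) ?_ using 1
    · ext x
      simp only [Finset.mem_union, Finset.mem_Ioc, Finset.mem_Ioo, Finset.mem_Icc]
      omega
    · rw [Finset.disjoint_left]
      intro x
      simp only [Finset.mem_Ioo, Finset.mem_Icc]
      omega

/-- The parity clause is the opposite of what (III) demands of the partner of `N`; it separates the
two kinds of values of `φ`. -/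
lemma exc_spec (hNodd : Odd N) (hB : B ∈ X2plus N) (h0 : (even B).card ≠ 0) :
    1 ≤ exc N B ∧ exc N B < N ∧ insert {exc N B, N} B ∈ X1 N ∧
      (Even (exc N B) ↔ Odd (even (insert {exc N B, N} B)).card) := by
  obtain ⟨s, i, hi, hs, h⟩ := isExc_exc hB h0
  have hs1 : 1 ≤ s := hs.pos
  rcases h with ⟨⟨-, h3⟩, hu, h1, h2⟩ | ⟨⟨h1, -⟩, hu, h2, h3⟩
  · obtain ⟨huN, huodd, hX, hc⟩ := hB.1.insert_left hNodd hB.2.1 hi hs1 hu h1 h2 h3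
    refine ⟨(Finset.mem_Ico.1 hu).1, huN, hX, ?_⟩
    rw [hc]
    exact iff_of_false (Nat.not_even_iff_odd.2 huodd) (Nat.not_odd_iff_even.2 hs.add_one)
  · obtain ⟨hu1, hueven, hX, hc⟩ := hB.1.insert_right hNodd hB.2.1 hi hs1 hu h1 h2 h3
    refine ⟨hu1, (Finset.mem_Ioo.1 hu).2, hX, ?_⟩
    rw [hc]
    exact iff_of_true hueven hs

/-! ### The map `φ` -/

lemma phi_mem_X1 (hNodd : Odd N) (hB : B ∈ X2 N) : phi N B ∈ X1 N := by
  unfold phi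
  split_ifs with h
  · exact (exc_spec hNodd h.1 h.2).2.2.1
  · rcases hB with hB | hB
    · have h0 : (even B).card = 0 := by
        by_contra h0
        exact h ⟨hB, h0⟩
      -- Without even pairs condition (I) is void.
      exact ⟨hB.1, 0, id, isSeq_zero h0, Or.inl rfl⟩
    · exact ⟨hB.1, hB.2.1⟩

lemma subset_phi : B ⊆ phi N B := by
  unfold phi
  split_ifs
  exacts [Finset.subset_insert _ _, Finset.Subset.refl B]

/-- The correction `c_B` is precisely the arc of the added pair `{u_B, N}`. -/
lemma eps'_eq_eps_phi (hNodd : Odd N) : eps' N B = eps N (phi N B) := by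
  unfold eps' phi
  by_cases h : B ∈ X2plus N ∧ (even B).card ≠ 0
  · obtain ⟨hu1, huN, -, -⟩ := exc_spec hNodd h.1 h.2
    have hn : ({exc N B, N} : Finset ℕ) ∉ B := fun hm =>
      h.1.2.1 (mem_supp.2 ⟨_, hm, by simp⟩)
    rw [Nat.odd_iff] at hNodd
    rw [if_pos h, if_pos h, eps, Finset.sum_insert hn]
    split_ifs with he
    · rw [Nat.even_iff] at he
      rw [add_comm]
      congr 1
      funext k
      unfold ind
      refine if_congr ?_ rfl rfl
      have hk := Finset.mem_Icc.1 k.2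
      rw [mem_bracket_pair huN, Finset.mem_Icc]
      omega
    · rw [Nat.not_even_iff] at he
      rw [add_assoc, add_comm]
      congr 1
      funext k
      have hk := Finset.mem_Icc.1 k.2
      simp only [ind, Pi.add_apply, mem_bracket_pair huN, Finset.mem_Icc, Finset.mem_singleton]
      by_cases h1 : (k : ℕ) = N
      · rw [if_pos h1, if_neg (by omega), if_pos (by omega), add_zero]
      · rw [if_neg h1, zero_add]
        exact if_congr (by omega) rfl rfl
  · rw [if_neg h, if_neg h, eps]

lemma spanB_mono (h : B ⊆ C) : spanB N B ≤ spanB N C :=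
  Submodule.span_mono (Set.image_mono (Finset.coe_subset.2 h))

/-- The added pair contains `N`, which excludes (II), and has the wrong parity for (III). -/
lemma insert_exc_notMem_X2 (hNodd : Odd N) (hB : B ∈ X2plus N) (h0 : (even B).card ≠ 0) :
    insert {exc N B, N} B ∉ X2 N := by
  obtain ⟨hu1, huN, hX, hpar⟩ := exc_spec hNodd hB h0
  have hm := Finset.mem_insert_self {exc N B, N} B
  rintro (h | h)
  · exact h.2.1 (mem_supp.2 ⟨_, hm, by simp⟩)
  · obtain ⟨-, he, ho⟩ := h.2
    have key : ∀ i : ℕ, {i, N} ∈ insert {exc N B, N} B → i = exc N B := by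
      intro i hi
      have heq := h.1.1.eq_of_mem hi hm (k := N) (by simp) (by simp)
      have hc := (h.1.1.1 _ hi).2
      have hi' : i ∈ ({exc N B, N} : Finset ℕ) := by rw [← heq]; simp
      simp only [Finset.mem_insert, Finset.mem_singleton] at hi'
      rcases hi' with hi' | rfl
      · exact hi'
      · simp at hc
    by_cases hu : Even (exc N B)
    · obtain ⟨i, hi, him⟩ := ho (hpar.1 hu)
      rw [key i him] at hi
      exact Nat.not_even_iff_odd.2 hi hu
    · obtain ⟨i, hi, him⟩ := he (Nat.not_odd_iff_even.1 fun h => hu (hpar.2 h))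
      rw [key i him] at hi
      exact hu hi

lemma filter_notMem_insert_exc (hB : N ∉ supp B) (u : ℕ) :
    (insert {u, N} B).filter (fun X => N ∉ X) = B := by
  rw [Finset.filter_insert, if_neg (by simp), Finset.filter_eq_self]
  exact fun X hX h => hB (mem_supp.2 ⟨X, hX, h⟩)

/-- An enlarged family lies outside `𝒳_{N-2}`, so it is never an unchanged one; deleting the pair
through `N` undoes the enlargement. -/
lemma phi_injOn (hNodd : Odd N) : Set.InjOn (phi N) (X2 N) := by
  intro B hB C hC h
  unfold phi at h
  split_ifs at h with h1 h2 h2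
  · rw [← filter_notMem_insert_exc h1.1.2.1, h, filter_notMem_insert_exc h2.1.2.1]
  · exact absurd (h ▸ hC) (insert_exc_notMem_X2 hNodd h1.1 h1.2)
  · exact absurd (h ▸ hB) (insert_exc_notMem_X2 hNodd h2.1 h2.2)
  · exact h

/-! ### The orders -/

lemma openCount_le_of_le1 (hNodd : Odd N) {B C : X1 N} (h : le1 N B C) {k : ℕ} (hk : k ≤ N) :
    openCount B.1 k ≤ openCount C.1 k := by
  induction h with
  | refl => exact le_rfl
  | tail _ hs ih =>
    exact ih.trans ((isArcSystem_of_mem_X1 (Subtype.prop _)).openCount_le_of_eps_mem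
      (isArcSystem_of_mem_X1 (Subtype.prop _)) hNodd hs hk)

lemma le1_antisymm (hNodd : Odd N) {B C : X1 N} (h : le1 N B C) (h' : le1 N C B) : B = C :=
  Subtype.ext ((isArcSystem_of_mem_X1 B.2).eq_of_openCount_eq (isArcSystem_of_mem_X1 C.2) hNodd
    fun _ hk => (openCount_le_of_le1 hNodd h hk).antisymm (openCount_le_of_le1 hNodd h' hk))

lemma le1_phi_of_preceq (hNodd : Odd N) {B C : X2 N} (h : preceq N B C) :
    le1 N ⟨phi N B.1, phi_mem_X1 hNodd B.2⟩ ⟨phi N C.1, phi_mem_X1 hNodd C.2⟩ := by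
  induction h with
  | refl => exact Relation.ReflTransGen.refl
  | tail _ hs ih =>
    refine Relation.ReflTransGen.tail ih ?_
    -- Each link survives, because enlarging the target family only enlarges its span.
    rw [← eps'_eq_eps_phi hNodd]
    exact spanB_mono subset_phi hs

lemma preceq_antisymm (hNodd : Odd N) {B C : X2 N} (h : preceq N B C) (h' : preceq N C B) :
    B = C :=
  Subtype.ext (phi_injOn hNodd B.2 C.2 (congrArg Subtype.val
    (le1_antisymm hNodd (le1_phi_of_preceq hNodd h) (le1_phi_of_preceq hNodd h'))))

end Covered

end PairOrder

theorem mainTheorem3 (N : ℕ) (hN : 3 ≤ N) (hodd : Odd N) :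
    IsPartialOrder (PairOrder.X2 N) (PairOrder.preceq N) ∧
    ∀ B' B : PairOrder.X2 N, PairOrder.preceq N B' B →
      ∃ (h' : PairOrder.phi N B'.1 ∈ PairOrder.X1 N) (h : PairOrder.phi N B.1 ∈ PairOrder.X1 N),
        PairOrder.le1 N ⟨PairOrder.phi N B'.1, h'⟩ ⟨PairOrder.phi N B.1, h⟩ :=
  ⟨{ refl := fun _ => Relation.ReflTransGen.refl
     trans := fun _ _ _ => Relation.ReflTransGen.trans
     antisymm := fun _ _ => PairOrder.preceq_antisymm hodd },
    fun B' B h => ⟨PairOrder.phi_mem_X1 hodd B'.2, PairOrder.phi_mem_X1 hodd B.2,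
      PairOrder.le1_phi_of_preceq hodd h⟩⟩
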